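/- Proposition 3.3. Let $n\ge 3$, let $I\subseteq(0,\infty)$ be an open interval and $t=t(r)$, $r\in I$, a non-constant $C^\infty$ function. Let $M$ be the rotational hypersurface in $\mathbb R^{n+1}$ with meridian $t=t(r)$ around an axis $\{o+se: s\in\mathbb R\}$, $\|e\|=1$, i.e. the union over $r\in I$ of the spheres $\{X : \|X-x_0\|=r,\ \langle e,X-x_0\rangle=0\}$ with $x_0=o+t(r)e$, with the induced metric $g$, Levi-Civita connection $\nabla$ and curvature tensor $R(X,Y,Z,U)=g(\nabla_X\nabla_YZ-\nabla_Y\nabla_XZ-\nabla_{[X,Y]}Z,U)$. For a 2-plane $E\subseteq T_pM$ with orthonormal basis $X,Y$, the sectional 1-form of $E$ is $\varphi_E(Z)=(\nabla_ZR)(X,Y,Y,X)$, $Z\in E$ (it does not depend on the basis). $M$ is called of pointwise constant relative sectional curvature if there is a smooth 1-form $\eta$ of unit length on $M$ such that, at each $p\in M$, $\varphi_E=0$ for all 2-planes $E\subseteq\ker\eta_p$, and $\varphi_E=k(p)\,\eta|_E$ for all 2-planes $E\not\subseteq\ker\eta_p$, with a number $k(p)$ that does not depend on $E$. Then $M$ is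 of pointwise constant relative sectional curvature if and only if there are real constants $A,B$ and a sign $\varepsilon\in\{1,-1\}$ (the orientation of the axis) such that for all $r\in I$ $$0<(Ar^2+B)r^2<1,$$ and for all $r_0,r\in I$ $$t(r)-t(r_0)=\varepsilon\int_{r_0}^{r}\frac{s\sqrt{As^2+B}}{\sqrt{1-As^4-Bs^2}}\,ds .$$ -/

import Mathlib

open scoped ContDiff RealInnerProductSpace

noncomputable section

namespace RelCurv

/-! ### Riemannian metrics on an open set of a vector space (a chart) -/

section Metric

variable {W : Type*} [NormedAddCommGroup W] [NormedSpace ℝ W]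

/-- A field of bilinear forms on `W`; a Riemannian metric on an open `U ⊆ W` is such a field
(only its values on `U` matter), symmetric, positive definite and smooth on `U`. -/
abbrev MetricField (W : Type*) [NormedAddCommGroup W] [NormedSpace ℝ W] :=
  W → W →L[ℝ] W →L[ℝ] ℝ

/-- Christoffel symbols of the first kind, as the covector
`w ↦ ½ (∂_u g(v,w) + ∂_v g(u,w) - ∂_w g(u,v))` at `p`. -/
def christoffelLower (g : MetricField W) (p u v : W) : W →L[ℝ] ℝ :=
  (1 / 2 : ℝ) • (fderiv ℝ g p u v + fderiv ℝ g p v u - ((fderiv ℝ g p).flip u).flip v)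

/-- Christoffel symbols `Γ(u, v)` of the Levi-Civita connection of `g` at `p`: the index of
`christoffelLower` is raised by the inverse of `g p : W → W*`. -/
def christoffel (g : MetricField W) (p u v : W) : W :=
  (g p).inverse (christoffelLower g p u v)

/-- The Levi-Civita covariant derivative `∇_X Y` of vector fields. -/
def covDeriv (g : MetricField W) (X Y : W → W) : W → W :=
  fun p => fderiv ℝ Y p (X p) + christoffel g p (X p) (Y p)

/-- The (0,4) curvature tensor `R(x,y,z,u) = g(∇_x ∇_y z - ∇_y ∇_x z - ∇_[x,y] z, u)` at `p`.
The tangent vectors are extended to constant vector fields of the chart, whose brackets vanish. -/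
def curvature (g : MetricField W) (p x y z u : W) : ℝ :=
  g p (covDeriv g (fun _ => x) (covDeriv g (fun _ => y) (fun _ => z)) p
    - covDeriv g (fun _ => y) (covDeriv g (fun _ => x) (fun _ => z)) p) u

/-- The covariant derivative `(∇_w R)(x,y,z,u)` of the curvature tensor at `p`. -/
def covDerivCurvature (g : MetricField W) (p w x y z u : W) : ℝ :=
  fderiv ℝ (fun q => curvature g q x y z u) p w
    - curvature g p (christoffel g p w x) y z u
    - curvature g p x (christoffel g p w y) z u
    - curvature g p x y (christoffel g p w z) u
    - curvature g p x y z (christoffel g p w u)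

/-- `x, y` is a `g`-orthonormal basis of the 2-plane `E ⊆ T_p`. -/
def IsOrthonormalBasisOf (g : MetricField W) (p x y : W) (E : Submodule ℝ W) : Prop :=
  g p x x = 1 ∧ g p y y = 1 ∧ g p x y = 0 ∧ Submodule.span ℝ {x, y} = E

/-- The sectional 1-form `φ_E(z) = (∇_z R)(x,y,y,x)`, `z ∈ E`, of the 2-plane `E` at `p` equals
the restriction to `E` of the covector `c` (`x, y` any orthonormal basis of `E`). -/
def SectionalFormEq (g : MetricField W) (p : W) (E : Submodule ℝ W) (c : W →L[ℝ] ℝ) : Prop :=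
  ∀ x y, IsOrthonormalBasisOf g p x y E → ∀ z ∈ E, covDerivCurvature g p z x y y x = c z

/-- `η` is a smooth 1-form on `U` of unit length: `η = g(ξ, ·)` with `g(ξ, ξ) = 1`. -/
def IsUnitOneForm (g : MetricField W) (U : Set W) (η : W → W →L[ℝ] ℝ) : Prop :=
  ContDiffOn ℝ ∞ η U ∧ ∀ p ∈ U, ∃ ξ : W, g p ξ ξ = 1 ∧ η p = g p ξ

/-- `k` is the relative sectional curvature of the 2-plane `E` at `p`: `φ_E = k η|_E`. -/
def HasRelativeSectionalCurvature (g : MetricField W) (η : W → W →L[ℝ] ℝ) (p : W)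
    (E : Submodule ℝ W) (k : ℝ) : Prop :=
  SectionalFormEq g p E (k • η p)

/-- `(U, g)` is directed by the unit 1-form `η`, with distribution `Δ(p) = ker η(p)`. -/
def IsDirectedBy (g : MetricField W) (U : Set W) (η : W → W →L[ℝ] ℝ) : Prop :=
  IsUnitOneForm g U η ∧
    ∀ p ∈ U, ∀ E : Submodule ℝ W, Module.finrank ℝ E = 2 →
      (¬ E ≤ LinearMap.ker (η p).toLinearMap → ∃ k, HasRelativeSectionalCurvature g η p E k) ∧
      (E ≤ LinearMap.ker (η p).toLinearMap → SectionalFormEq g p E 0)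

/-- `(U, g)` is a directed Riemannian manifold of pointwise constant relative sectional
curvature: at each point the relative sectional curvatures of all 2-planes `E ⊄ Δ` agree. -/
def HasPointwiseConstantRelativeSectionalCurvature (g : MetricField W) (U : Set W) : Prop :=
  ∃ η : W → W →L[ℝ] ℝ, IsDirectedBy g U η ∧
    ∀ p ∈ U, ∃ k : ℝ, ∀ E : Submodule ℝ W, Module.finrank ℝ E = 2 →
      ¬ E ≤ LinearMap.ker (η p).toLinearMap → HasRelativeSectionalCurvature g η p E k

end Metric

/-! ### Rotational hypersurfaces -/

section Rotational

variable {V : Type*} [NormedAddCommGroup V] [InnerProductSpace ℝ V]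

/-- The first fundamental form (induced metric) of a parametrization `X : W → V`. -/
def firstFundamentalForm {W : Type*} [NormedAddCommGroup W] [NormedSpace ℝ W] (X : W → V) :
    MetricField W :=
  fun p => (innerSL ℝ : V →L[ℝ] V →L[ℝ] ℝ).bilinearComp (fderiv ℝ X p) (fderiv ℝ X p)

/-- The rotational hypersurface with axis through `o` in the unit direction `e` and meridian
`t = t(r)`, `r ∈ I`: the union of the spheres `‖X - x₀‖ = r`, `⟪e, X - x₀⟫ = 0` with centres
`x₀ = o + t(r) e` on the axis. -/
def rotationalHypersurface (o e : V) (t : ℝ → ℝ) (I : Set ℝ) : Set V :=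
  {X | ∃ r ∈ I, ‖X - (o + t r • e)‖ = r ∧ ⟪e, X - (o + t r • e)⟫ = 0}

/-- The global parametrization `w ↦ o + w + t(‖w‖) e` of the rotational hypersurface by the
hyperplane orthogonal to the axis. -/
def rotationalChart (o e : V) (t : ℝ → ℝ) (w : (ℝ ∙ e)ᗮ) : V :=
  o + (w : V) + t ‖w‖ • e

/-- The domain of `rotationalChart`: the annulus of all `w ⟂ e` with `‖w‖ ∈ I`. -/
def rotationalDomain (e : V) (I : Set ℝ) : Set (ℝ ∙ e)ᗮ := {w | ‖w‖ ∈ I}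

theorem image_rotationalChart (o e : V) (t : ℝ → ℝ) (I : Set ℝ) :
    rotationalChart o e t '' rotationalDomain e I = rotationalHypersurface o e t I := by
  ext X
  constructor
  · rintro ⟨w, hw, rfl⟩
    have h : rotationalChart o e t w - (o + t ‖w‖ • e) = w := by
      simp only [rotationalChart]; abel
    exact ⟨‖w‖, hw, by rw [h, Submodule.coe_norm],
      by rw [h]; exact Submodule.mem_orthogonal_singleton_iff_inner_right.mp w.2⟩
  · rintro ⟨r, hr, h1, h2⟩
    refine ⟨⟨X - (o + t r • e), Submodule.mem_orthogonal_singleton_iff_inner_right.mpr h2⟩, ?_, ?_⟩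
    · simpa [rotationalDomain, h1] using hr
    · simp only [rotationalChart, Submodule.coe_norm, h1]; abel

theorem injective_rotationalChart (o e : V) (he : ‖e‖ = 1) (t : ℝ → ℝ) :
    Function.Injective (rotationalChart o e t) := by
  have key : ∀ w : (ℝ ∙ e)ᗮ, ⟪e, rotationalChart o e t w - o⟫ = t ‖w‖ := by
    intro w
    have h : rotationalChart o e t w - o = w + t ‖w‖ • e := by
      simp only [rotationalChart]; abel
    rw [h, inner_add_right, Submodule.mem_orthogonal_singleton_iff_inner_right.mp w.2,
      real_inner_smul_right, real_inner_self_eq_norm_sq, he]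
    ring
  intro v w h
  have h' : t ‖v‖ = t ‖w‖ := by rw [← key v, ← key w, h]
  apply Subtype.ext
  simp only [rotationalChart, h'] at h
  exact add_left_cancel (add_right_cancel h)

/-- The metric induced on the rotational hypersurface, in the global chart. -/
def rotationalMetric (o e : V) (t : ℝ → ℝ) : MetricField (ℝ ∙ e)ᗮ :=
  firstFundamentalForm (rotationalChart o e t)

end Rotational

end RelCurv

end

/-! In the chart `w ↦ o + w + t(‖w‖) e` the induced metric is the Euclidean one plus `t'² / r²`
times the square of `⟪w, ·⟫`. Put `s = r²` and let `α(s) = t'² / (s (1 + t'²))`, the curvature of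
the planes tangent to the parallels; then `t'² / r² = α / (1 - α s)`. The Christoffel symbols are
radial, and for a `g`-orthonormal basis `x, y` of `E` one finds (`IsRadialOn.covDerivCurvature_eq`)
`φ_E = (4 α' + 2 α'' (⟪p, x⟫² + ⟪p, y⟫²) / (1 - α s)) ⟪p, ·⟫`. Only the `α''` term sees how `E` is
tilted against the radial direction. If `α = A s + B`, the normalised radial covector serves as `η`;
conversely, two planes of different tilt, available since `n ≥ 3`, force `α'' = 0`.

It remains to solve `α = A s + B` for the meridian: `t'² = α s / (1 - α s)`, the square of the
integrand. Here `0 ≤ α` and `α s < 1` are automatic. A zero of `α` would make the affine function,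
hence `t'`, vanish identically, which is excluded. So `t'` has no zero, keeps one sign on the
interval, and integrates to the stated formula. -/

namespace RelCurv

/-! ### Radial metrics: first derivatives and raising of indices -/

section Radial

variable {W : Type*} [NormedAddCommGroup W] [InnerProductSpace ℝ W]

variable (W) in
/-- The inner product of `W` as a real bilinear form. -/
noncomputable def euclideanMetric : W →L[ℝ] W →L[ℝ] ℝ := innerSL ℝ

@[simp]
theorem euclideanMetric_apply (x y : W) : euclideanMetric W x y = ⟪x, y⟫ := rfl

/-- The rotationally symmetric metric `⟪x, y⟫ + h ⟪w, x⟫ ⟪w, y⟫`, where `h = α / (1 - α s)` with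
`s = ‖w‖ ^ 2`; the sectional curvature of the planes orthogonal to `w` is `α s`. -/
noncomputable def radialMetric (α : ℝ → ℝ) : MetricField W := fun w =>
  euclideanMetric W + (α (‖w‖ ^ 2) / (1 - α (‖w‖ ^ 2) * ‖w‖ ^ 2)) •
    (euclideanMetric W w).smulRight (euclideanMetric W w)

/-- The coefficient of `⟪w, u⟫ ⟪w, v⟫` in the Christoffel symbols of `radialMetric α`. -/
noncomputable def radialCoeff (α : ℝ → ℝ) (s : ℝ) : ℝ :=
  (deriv α s + α s ^ 2) / (1 - α s * s)

theorem radialMetric_apply (α : ℝ → ℝ) (w x y : W) :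
    radialMetric α w x y = ⟪x, y⟫ +
      α (‖w‖ ^ 2) / (1 - α (‖w‖ ^ 2) * ‖w‖ ^ 2) * (⟪w, x⟫ * ⟪w, y⟫) := by
  simp [radialMetric]

theorem hasFDerivAt_comp_normSq {f : ℝ → ℝ} {f' : ℝ} {p : W}
    (hf : HasDerivAt f f' (‖p‖ ^ 2)) :
    HasFDerivAt (fun w : W => f (‖w‖ ^ 2)) ((2 * f') • innerSL ℝ p) p := by
  have h := hf.comp_hasFDerivAt p (hasStrictFDerivAt_norm_sq p).hasFDerivAt
  refine h.congr_fderiv ?_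
  ext v
  simp
  ring

theorem hasFDerivAt_inner_left (p x : W) :
    HasFDerivAt (fun w : W => ⟪w, x⟫) (innerSL ℝ x) p := by
  have := (innerSL ℝ x).hasFDerivAt (x := p)
  simpa [real_inner_comm] using this

theorem hasDerivAt_radial_h {α : ℝ → ℝ} {a s : ℝ} (hα : HasDerivAt α a s)
    (hD : 1 - α s * s ≠ 0) :
    HasDerivAt (fun s => α s / (1 - α s * s)) ((a + α s ^ 2) / (1 - α s * s) ^ 2) s := by
  have h := hα.div ((hasDerivAt_const s (1 : ℝ)).sub (hα.mul (hasDerivAt_id s))) hD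
  refine h.congr_deriv ?_
  simp
  ring

theorem hasDerivAt_radialCoeff {α : ℝ → ℝ} {b s : ℝ} (hα : HasDerivAt α (deriv α s) s)
    (hα' : HasDerivAt (deriv α) b s) (hD : 1 - α s * s ≠ 0) :
    HasDerivAt (radialCoeff α) (((b + 2 * α s * deriv α s) * (1 - α s * s) +
      (deriv α s + α s ^ 2) * (α s + deriv α s * s)) / (1 - α s * s) ^ 2) s := by
  have h := (hα'.add (hα.pow 2)).div
    ((hasDerivAt_const s (1 : ℝ)).sub (hα.mul (hasDerivAt_id s))) hD
  refine h.congr_deriv ?_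
  simp
  ring

theorem differentiableAt_const_add_smul {F : Type*} [NormedAddCommGroup F] [NormedSpace ℝ F]
    (c : F) {f : W → ℝ} {B : W → F} {p : W} (hf : DifferentiableAt ℝ f p)
    (hB : DifferentiableAt ℝ B p) : DifferentiableAt ℝ (fun w => c + f w • B w) p :=
  (differentiableAt_const c).add (hf.smul hB)

theorem fderiv_radialMetric {α : ℝ → ℝ} {p : W} (hα : DifferentiableAt ℝ α (‖p‖ ^ 2))
    (hD : 1 - α (‖p‖ ^ 2) * ‖p‖ ^ 2 ≠ 0) (u v w : W) :
    fderiv ℝ (radialMetric α) p u v w =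
      2 * ((deriv α (‖p‖ ^ 2) + α (‖p‖ ^ 2) ^ 2) / (1 - α (‖p‖ ^ 2) * ‖p‖ ^ 2) ^ 2) *
        ⟪p, u⟫ * ⟪p, v⟫ * ⟪p, w⟫ +
      α (‖p‖ ^ 2) / (1 - α (‖p‖ ^ 2) * ‖p‖ ^ 2) * (⟪u, v⟫ * ⟪p, w⟫ + ⟪p, v⟫ * ⟪u, w⟫) := by
  have hh := hasFDerivAt_comp_normSq (W := W) (hasDerivAt_radial_h hα.hasDerivAt hD)
  have hB : DifferentiableAt ℝ
      (fun w : W => (euclideanMetric W w).smulRight (euclideanMetric W w)) p := by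
    have h : ContDiff ℝ 1 (fun w : W => (euclideanMetric W w).smulRight (euclideanMetric W w)) :=
      (euclideanMetric W).contDiff.smulRight (euclideanMetric W).contDiff
    exact h.differentiable (by norm_num) p
  have hg : DifferentiableAt ℝ (radialMetric α : MetricField W) p := by
    exact differentiableAt_const_add_smul (F := W →L[ℝ] W →L[ℝ] ℝ) (euclideanMetric W)
      hh.differentiableAt hB
  -- Evaluation at fixed `v, w` commutes with the derivative, so uniqueness reduces the
  -- operator-valued derivative to that of the scalar formula.
  have h1 := ((hg.hasFDerivAt.clm_apply (hasFDerivAt_const v p)).clm_apply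
    (hasFDerivAt_const w p)).unique
    (((hasFDerivAt_const ⟪v, w⟫ p).add (hh.mul ((hasFDerivAt_inner_left p v).mul
      (hasFDerivAt_inner_left p w)))).congr_of_eventuallyEq
      (Filter.Eventually.of_forall fun q => by
        simpa using radialMetric_apply α q v w))
  have h2 := congrArg (fun L => L u) h1
  simp at h2
  rw [h2, real_inner_comm v u, real_inner_comm w u]
  ring

/-- `ContinuousLinearMap.inverse` takes the default value `0` on maps that are not invertible, so
nondegeneracy is first upgraded to an equivalence by comparing the dimensions of `W` and its dual.
-/
theorem christoffel_eq_of_forall [FiniteDimensional ℝ W] {g : MetricField W} {p u v c : W}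
    (hinj : ∀ x, g p x = 0 → x = 0) (hc : ∀ w, g p c w = christoffelLower g p u v w) :
    christoffel g p u v = c := by
  have hL : christoffelLower g p u v = g p c := by ext w; exact (hc w).symm
  have hk : LinearMap.ker (g p).toLinearMap = ⊥ := by
    rw [LinearMap.ker_eq_bot']; exact hinj
  have hfr : Module.finrank ℝ W = Module.finrank ℝ (W →L[ℝ] ℝ) :=
    ((InnerProductSpace.toDual ℝ W).toLinearEquiv.finrank_eq)
  let E := ((g p).toLinearMap.linearEquivOfInjective (LinearMap.ker_eq_bot.mp hk)
    hfr).toContinuousLinearEquiv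
  have hE : (E : W →L[ℝ] W →L[ℝ] ℝ) = g p := by
    ext x y; rfl
  rw [christoffel, hL, ← hE, ContinuousLinearMap.inverse_equiv]
  simp

end Radial
-- Connection, curvature and sectional 1-form of a radial metric
section Radial

variable {W : Type*} [NormedAddCommGroup W] [InnerProductSpace ℝ W]

/-- `g` agrees on the open set `U` with the rotationally symmetric metric `radialMetric α`, where
`α` is twice differentiable and the metric is positive definite. -/
structure IsRadialOn (g : MetricField W) (α : ℝ → ℝ) (U : Set W) : Prop where
  isOpen : IsOpen U
  eq : ∀ w ∈ U, g w = radialMetric α w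
  diff : ∀ w ∈ U, DifferentiableAt ℝ α (‖w‖ ^ 2)
  diff_deriv : ∀ w ∈ U, DifferentiableAt ℝ (deriv α) (‖w‖ ^ 2)
  pos : ∀ w ∈ U, 0 < 1 - α (‖w‖ ^ 2) * ‖w‖ ^ 2

namespace IsRadialOn

variable {g : MetricField W} {α : ℝ → ℝ} {U : Set W} {p : W}

theorem apply (h : IsRadialOn g α U) (hp : p ∈ U) (x y : W) :
    g p x y = ⟪x, y⟫ + α (‖p‖ ^ 2) / (1 - α (‖p‖ ^ 2) * ‖p‖ ^ 2) * (⟪p, x⟫ * ⟪p, y⟫) := by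
  rw [h.eq p hp, radialMetric_apply]

theorem ne_zero (h : IsRadialOn g α U) (hp : p ∈ U) : 1 - ‖p‖ ^ 2 * α (‖p‖ ^ 2) ≠ 0 := by
  rw [mul_comm]
  exact (h.pos p hp).ne'

theorem apply_self (h : IsRadialOn g α U) (hp : p ∈ U) (y : W) :
    g p p y = ⟪p, y⟫ / (1 - α (‖p‖ ^ 2) * ‖p‖ ^ 2) := by
  have hD := h.ne_zero hp
  rw [h.apply hp, real_inner_self_eq_norm_sq]
  field_simp
  ring

theorem christoffelLower_eq (h : IsRadialOn g α U) (hp : p ∈ U) (u v w : W) :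
    christoffelLower g p u v w =
      (α (‖p‖ ^ 2) * ⟪u, v⟫ + radialCoeff α (‖p‖ ^ 2) * ⟪p, u⟫ * ⟪p, v⟫) *
        (⟪p, w⟫ / (1 - α (‖p‖ ^ 2) * ‖p‖ ^ 2)) := by
  have hD := h.ne_zero hp
  have he : g =ᶠ[nhds p] radialMetric α :=
    Filter.eventually_of_mem (h.isOpen.mem_nhds hp) h.eq
  simp only [christoffelLower, he.fderiv_eq, smul_apply, add_apply, sub_apply,
    ContinuousLinearMap.flip_apply, fderiv_radialMetric (h.diff p hp) (h.pos p hp).ne', radialCoeff, smul_eq_mul]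
  rw [real_inner_comm u v, real_inner_comm u w, real_inner_comm v w]
  field_simp
  ring

theorem hasDerivAt_coeff (h : IsRadialOn g α U) (hp : p ∈ U) :
    HasDerivAt (radialCoeff α) (deriv (radialCoeff α) (‖p‖ ^ 2)) (‖p‖ ^ 2) :=
  (hasDerivAt_radialCoeff (h.diff p hp).hasDerivAt (h.diff_deriv p hp).hasDerivAt
    (h.pos p hp).ne').differentiableAt.hasDerivAt

variable [FiniteDimensional ℝ W]

/-- The lowered symbol is a multiple of `⟪p, ·⟫`, and `g(p, ·) = ⟪p, ·⟫ / (1 - α s)`, so raising the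
index gives a multiple of `p`. -/
theorem christoffel_eq (h : IsRadialOn g α U) (hp : p ∈ U) (u v : W) :
    christoffel g p u v =
      (α (‖p‖ ^ 2) * ⟪u, v⟫ + radialCoeff α (‖p‖ ^ 2) * ⟪p, u⟫ * ⟪p, v⟫) • p := by
  refine christoffel_eq_of_forall (fun x hx => ?_) fun w => ?_
  · have h1 : g p x p = 0 := by rw [hx]; rfl
    have h2 : g p x x = 0 := by rw [hx]; rfl
    have hD := h.ne_zero hp
    rw [h.apply hp, real_inner_comm, real_inner_self_eq_norm_sq] at h1
    have h3 : ⟪p, x⟫ = 0 := by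
      field_simp at h1
      simpa using h1
    rw [h.apply hp, h3] at h2
    simpa using h2
  · rw [map_smul, smul_apply, h.apply_self hp, h.christoffelLower_eq hp,
      smul_eq_mul]

theorem covDeriv_const_eq (h : IsRadialOn g α U) (hp : p ∈ U) (y z : W) :
    covDeriv g (fun _ => y) (fun _ => z) p =
      (α (‖p‖ ^ 2) * ⟪y, z⟫ + radialCoeff α (‖p‖ ^ 2) * ⟪p, y⟫ * ⟪p, z⟫) • p := by
  simp [covDeriv, h.christoffel_eq hp]

/-- The derivative of `radialCoeff α` may stay unevaluated: its term is symmetric in `x` and `y` and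
cancels in the curvature. -/
theorem covDeriv_covDeriv_const_eq (h : IsRadialOn g α U) (hp : p ∈ U) (x y z : W) :
    covDeriv g (fun _ => x) (covDeriv g (fun _ => y) (fun _ => z)) p =
      (2 * deriv α (‖p‖ ^ 2) * ⟪p, x⟫ * ⟪y, z⟫ +
        2 * deriv (radialCoeff α) (‖p‖ ^ 2) * ⟪p, x⟫ * ⟪p, y⟫ * ⟪p, z⟫ +
        radialCoeff α (‖p‖ ^ 2) * (⟪x, y⟫ * ⟪p, z⟫ + ⟪p, y⟫ * ⟪x, z⟫) +
        (α (‖p‖ ^ 2) * ⟪y, z⟫ + radialCoeff α (‖p‖ ^ 2) * ⟪p, y⟫ * ⟪p, z⟫) *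
          (α (‖p‖ ^ 2) + radialCoeff α (‖p‖ ^ 2) * ‖p‖ ^ 2) * ⟪p, x⟫) • p +
      (α (‖p‖ ^ 2) * ⟪y, z⟫ + radialCoeff α (‖p‖ ^ 2) * ⟪p, y⟫ * ⟪p, z⟫) • x := by
  have he : covDeriv g (fun _ => y) (fun _ => z) =ᶠ[nhds p] fun q =>
      (α (‖q‖ ^ 2) * ⟪y, z⟫ + radialCoeff α (‖q‖ ^ 2) * ⟪q, y⟫ * ⟪q, z⟫) • q :=
    Filter.eventually_of_mem (h.isOpen.mem_nhds hp) fun q hq => h.covDeriv_const_eq hq y z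
  have hα := hasFDerivAt_comp_normSq (h.diff p hp).hasDerivAt
  have hβ := hasFDerivAt_comp_normSq (h.hasDerivAt_coeff hp)
  have hF := (((hα.mul_const ⟪y, z⟫).add ((hβ.mul (hasFDerivAt_inner_left p y)).mul
    (hasFDerivAt_inner_left p z))).smul (hasFDerivAt_id p)).congr_of_eventuallyEq he
  rw [covDeriv, hF.fderiv, h.covDeriv_const_eq hp, h.christoffel_eq hp]
  simp only [add_apply, smul_apply,
    ContinuousLinearMap.smulRight_apply, innerSL_apply_apply, smul_eq_mul, Pi.add_apply,
    Pi.mul_apply, ContinuousLinearMap.id_apply, id, inner_smul_right, real_inner_self_eq_norm_sq]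
  rw [real_inner_comm x y, real_inner_comm x z, real_inner_comm p x]
  module

theorem curvature_eq (h : IsRadialOn g α U) (hp : p ∈ U) (x y z u : W) :
    curvature g p x y z u =
      α (‖p‖ ^ 2) * (⟪y, z⟫ * ⟪x, u⟫ - ⟪x, z⟫ * ⟪y, u⟫) +
      radialCoeff α (‖p‖ ^ 2) *
        (⟪p, z⟫ * ⟪p, y⟫ * ⟪x, u⟫ - ⟪p, z⟫ * ⟪p, x⟫ * ⟪y, u⟫ +
          ⟪p, u⟫ * ⟪p, x⟫ * ⟪y, z⟫ - ⟪p, u⟫ * ⟪p, y⟫ * ⟪x, z⟫) := by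
  have hD := h.ne_zero hp
  rw [curvature, h.covDeriv_covDeriv_const_eq hp, h.covDeriv_covDeriv_const_eq hp]
  simp only [map_sub, map_add, map_smul, sub_apply,
    add_apply, smul_apply, h.apply_self hp, smul_eq_mul]
  rw [h.apply hp x u, h.apply hp y u, real_inner_comm x y, radialCoeff]
  field_simp
  ring

/-- The sectional 1-form of a radial metric. -/
theorem covDerivCurvature_eq (h : IsRadialOn g α U) (hp : p ∈ U) {x y z : W}
    (hx : g p x x = 1) (hy : g p y y = 1) (hxy : g p x y = 0) (hz : z ∈ Submodule.span ℝ {x, y}) :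
    covDerivCurvature g p z x y y x =
      (4 * deriv α (‖p‖ ^ 2) + 2 * deriv (deriv α) (‖p‖ ^ 2) * (⟪p, x⟫ ^ 2 + ⟪p, y⟫ ^ 2) /
        (1 - α (‖p‖ ^ 2) * ‖p‖ ^ 2)) * ⟪p, z⟫ := by
  have hD := h.ne_zero hp
  have he : (fun q => curvature g q x y y x) =ᶠ[nhds p] fun q =>
      α (‖q‖ ^ 2) * (⟪y, y⟫ * ⟪x, x⟫ - ⟪x, y⟫ * ⟪y, x⟫) +
      radialCoeff α (‖q‖ ^ 2) *
        (⟪q, y⟫ * ⟪q, y⟫ * ⟪x, x⟫ - ⟪q, y⟫ * ⟪q, x⟫ * ⟪y, x⟫ +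
          ⟪q, x⟫ * ⟪q, x⟫ * ⟪y, y⟫ - ⟪q, x⟫ * ⟪q, y⟫ * ⟪x, y⟫) :=
    Filter.eventually_of_mem (h.isOpen.mem_nhds hp) fun q hq => h.curvature_eq hq x y y x
  have hα := hasFDerivAt_comp_normSq (h.diff p hp).hasDerivAt
  -- Here the explicit derivative of `radialCoeff α` is needed; it is the source of `α''`.
  have hβ := hasFDerivAt_comp_normSq (hasDerivAt_radialCoeff (h.diff p hp).hasDerivAt
    (h.diff_deriv p hp).hasDerivAt (h.pos p hp).ne')
  have hX := hasFDerivAt_inner_left p x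
  have hY := hasFDerivAt_inner_left p y
  have hF := ((hα.mul_const (⟪y, y⟫ * ⟪x, x⟫ - ⟪x, y⟫ * ⟪y, x⟫)).add
    (hβ.mul (((((hY.mul hY).mul_const ⟪x, x⟫).sub ((hY.mul hX).mul_const ⟪y, x⟫)).add
      ((hX.mul hX).mul_const ⟪y, y⟫)).sub
      ((hX.mul hY).mul_const ⟪x, y⟫)))).congr_of_eventuallyEq he
  obtain ⟨a, b, rfl⟩ := Submodule.mem_span_pair.mp hz
  rw [covDerivCurvature, hF.fderiv]
  simp only [h.curvature_eq hp, h.christoffel_eq hp]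
  rw [h.apply hp] at hx hy hxy
  -- Orthonormality eliminates `⟪x, x⟫`, `⟪y, y⟫`, `⟪x, y⟫` in favour of `⟪p, x⟫` and `⟪p, y⟫`; what
  -- is left is a rational identity in independent variables.
  have hxx := eq_sub_of_add_eq hx
  have hyy := eq_sub_of_add_eq hy
  have hxy' := eq_neg_of_add_eq_zero_left hxy
  simp only [add_apply, smul_apply,
    sub_apply, innerSL_apply_apply, smul_eq_mul, inner_add_left,
    inner_add_right, real_inner_smul_left, real_inner_smul_right, Pi.add_apply, Pi.mul_apply,
    Pi.sub_apply, real_inner_self_eq_norm_sq p, real_inner_comm p x, real_inner_comm p y,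
    real_inner_comm x y]
  simp only [hxx, hyy, hxy', radialCoeff]
  have hD' := (h.pos p hp).ne'
  generalize deriv (deriv α) (‖p‖ ^ 2) = c''
  generalize deriv α (‖p‖ ^ 2) = c'
  generalize α (‖p‖ ^ 2) = c at hD hD' ⊢
  generalize ‖p‖ ^ 2 = s at hD hD' ⊢
  generalize ⟪p, x⟫ = X
  generalize ⟪p, y⟫ = Y
  field_simp
  ring

end IsRadialOn
end Radial
-- Pointwise constant relative sectional curvature of a radial metric
section Radial

variable {W : Type*} [NormedAddCommGroup W] [InnerProductSpace ℝ W]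

theorem exists_orthonormal_pair_orthogonal [FiniteDimensional ℝ W]
    (hW : 3 ≤ Module.finrank ℝ W) (p : W) :
    ∃ x y : W, ⟪p, x⟫ = 0 ∧ ⟪p, y⟫ = 0 ∧ ⟪x, x⟫ = 1 ∧ ⟪y, y⟫ = 1 ∧ ⟪x, y⟫ = 0 := by
  have h1 := Submodule.finrank_add_finrank_orthogonal (ℝ ∙ p)
  have h2 : Module.finrank ℝ (ℝ ∙ p) ≤ 1 :=
    (finrank_span_le_card ({p} : Set W)).trans (by simp)
  have h3 : 2 ≤ Module.finrank ℝ (ℝ ∙ p)ᗮ := by omega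
  let b := stdOrthonormalBasis ℝ (ℝ ∙ p)ᗮ
  let i : Fin (Module.finrank ℝ (ℝ ∙ p)ᗮ) := ⟨0, by omega⟩
  let j : Fin (Module.finrank ℝ (ℝ ∙ p)ᗮ) := ⟨1, by omega⟩
  have hb := orthonormal_iff_ite.mp b.orthonormal
  refine ⟨b i, b j, Submodule.mem_orthogonal_singleton_iff_inner_right.mp (b i).2,
    Submodule.mem_orthogonal_singleton_iff_inner_right.mp (b j).2, ?_, ?_, ?_⟩
  · exact (hb i i).trans (if_pos rfl)
  · exact (hb j j).trans (if_pos rfl)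
  · exact (hb i j).trans (if_neg (by simp [i, j]))

theorem finrank_span_pair_of_orthonormal {g : MetricField W} {p x y : W} (hx : g p x x = 1)
    (hy : g p y y = 1) (hxy : g p x y = 0) :
    Module.finrank ℝ (Submodule.span ℝ {x, y}) = 2 := by
  have hli : LinearIndependent ℝ ![x, y] := by
    rw [LinearIndependent.pair_iff]
    intro s t h
    -- Symmetry of `g p` is not available: pairing with `x` first removes `s`, so `g p y x` never
    -- matters.
    have h1 := congrArg (g p x) h
    simp only [map_add, map_smul, hx, hxy, smul_eq_mul, map_zero] at h1
    have hs : s = 0 := by linarith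
    subst hs
    have h2 := congrArg (g p y) h
    simp only [zero_smul, zero_add, map_smul, hy, smul_eq_mul, map_zero] at h2
    exact ⟨rfl, by linarith⟩
  have := finrank_span_eq_card hli
  rwa [Matrix.range_cons_cons_empty, Fintype.card_fin] at this

/-- If the relative sectional curvature is pointwise constant, then `φ_E` is a multiple of `η|_E`
with the same factor for all 2-planes `E`, including those in the kernel of `η`. -/
theorem HasPointwiseConstantRelativeSectionalCurvature.exists_covector {g : MetricField W}
    {U : Set W} (h : HasPointwiseConstantRelativeSectionalCurvature g U) {p : W} (hp : p ∈ U) :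
    ∃ c : W →L[ℝ] ℝ, ∀ x y z, g p x x = 1 → g p y y = 1 → g p x y = 0 →
      z ∈ Submodule.span ℝ {x, y} → covDerivCurvature g p z x y y x = c z := by
  obtain ⟨η, ⟨-, hη⟩, hk⟩ := h
  obtain ⟨k, hk⟩ := hk p hp
  refine ⟨k • η p, fun x y z hx hy hxy hz => ?_⟩
  have hE := finrank_span_pair_of_orthonormal hx hy hxy
  by_cases hle : Submodule.span ℝ {x, y} ≤ LinearMap.ker (η p).toLinearMap
  · have h0 : η p z = 0 := hle hz
    simpa [h0] using (hη p hp _ hE).2 hle x y ⟨hx, hy, hxy, rfl⟩ z hz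
  · exact hk _ hE hle x y ⟨hx, hy, hxy, rfl⟩ z hz

namespace IsRadialOn

variable {g : MetricField W} {α : ℝ → ℝ} {U : Set W} {p : W} [FiniteDimensional ℝ W]

/-- Nothing is known about the direction of `η`; linearity of the covector `c` alone is used,
comparing a plane that contains `p` with a tilted one. -/
theorem deriv_deriv_eq_zero (h : IsRadialOn g α U) (hW : 3 ≤ Module.finrank ℝ W)
    (hc : HasPointwiseConstantRelativeSectionalCurvature g U) (hp : p ∈ U) (hp0 : p ≠ 0) :
    deriv (deriv α) (‖p‖ ^ 2) = 0 := by
  obtain ⟨c, hc⟩ := hc.exists_covector hp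
  obtain ⟨x, y, hpx, hpy, hx, hy, hxy⟩ := exists_orthonormal_pair_orthogonal hW p
  have hs : 0 < ‖p‖ ^ 2 := by positivity
  have hD := h.pos p hp
  have gx : ∀ v, g p x v = ⟪x, v⟫ := fun v => by rw [h.apply hp, hpx]; ring
  have gy : ∀ v, g p v y = ⟪v, y⟫ := fun v => by rw [h.apply hp, hpy]; ring
  have gpx : g p p x = 0 := by rw [h.apply_self hp, hpx, zero_div]
  have gpy : g p p y = 0 := by rw [h.apply_self hp, hpy, zero_div]
  have gxp : g p x p = 0 := by rw [gx, real_inner_comm, hpx]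
  have gxx : g p x x = 1 := by rw [gx, hx]
  have gyy : g p y y = 1 := by rw [gy, hy]
  have gxy : g p x y = 0 := by rw [gx, hxy]
  have gpp : g p p p = ‖p‖ ^ 2 / (1 - α (‖p‖ ^ 2) * ‖p‖ ^ 2) := by
    rw [h.apply_self hp, real_inner_self_eq_norm_sq]
  -- `q = 1 / g(p, p)`, so `m • p` is a unit vector.
  set q := (1 - α (‖p‖ ^ 2) * ‖p‖ ^ 2) / ‖p‖ ^ 2 with hq
  have hqpos : 0 < q := div_pos hD hs
  set m := Real.sqrt q
  have hm : m ^ 2 = q := Real.sq_sqrt hqpos.le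
  have hm0 : 0 < m := Real.sqrt_pos.mpr hqpos
  have hmg : m ^ 2 * g p p p = 1 := by
    rw [hm, gpp, hq, div_mul_div_cancel₀ hs.ne', div_self hD.ne']
  have hcx : c x = 0 := by
    have h1 := hc x y x gxx gyy gxy (Submodule.subset_span (by simp))
    rw [h.covDerivCurvature_eq hp gxx gyy gxy (Submodule.subset_span (by simp)), hpx] at h1
    linarith
  have e1 := hc (m • p) x (m • p) (by simp; linarith) gxx (by simp [gpx])
    (Submodule.subset_span (by simp))
  rw [h.covDerivCurvature_eq hp (by simp; linarith) gxx (by simp [gpx])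
    (Submodule.subset_span (by simp))] at e1
  -- A unit vector between the radial direction and `x`; the Pythagorean triple keeps the
  -- coefficients rational.
  set z := (3 / 5 : ℝ) • m • p + (4 / 5 : ℝ) • x with hz
  have gzz : g p z z = 1 := by
    simp only [hz, map_add, map_smul, add_apply, smul_apply, smul_eq_mul, gpx, gxp, gxx]
    linarith
  have gzy : g p z y = 0 := by
    simp only [hz, map_add, map_smul, add_apply, smul_apply, smul_eq_mul, gpy, gxy]
    ring
  have e2 := hc z y z gzz gyy gzy (Submodule.subset_span (by simp))
  rw [h.covDerivCurvature_eq hp gzz gyy gzy (Submodule.subset_span (by simp))] at e2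
  have hpz : ⟪p, z⟫ = 3 / 5 * (m * ‖p‖ ^ 2) := by
    simp only [hz, inner_add_right, real_inner_smul_right, hpx, real_inner_self_eq_norm_sq]
    ring
  have hcz : c z = 3 / 5 * c (m • p) := by
    simp only [hz, map_add, map_smul, hcx, smul_eq_mul]
    ring
  rw [hcz, ← e1, hpz, hpx, hpy, real_inner_smul_right, real_inner_self_eq_norm_sq] at e2
  have hne : m * ‖p‖ ^ 2 * (m * ‖p‖ ^ 2) ^ 2 / (1 - α (‖p‖ ^ 2) * ‖p‖ ^ 2) ≠ 0 := by positivity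
  have : deriv (deriv α) (‖p‖ ^ 2) *
      (m * ‖p‖ ^ 2 * (m * ‖p‖ ^ 2) ^ 2 / (1 - α (‖p‖ ^ 2) * ‖p‖ ^ 2)) = 0 := by
    -- The two sides of `e2` differ in the `α''` term by the factor `2 · (3/5) · (1 - 9/25) =
    -- 96/125`.
    linear_combination (-125 / 96) * e2
  exact (mul_eq_zero.mp this).resolve_right hne

theorem hasPointwiseConstantRelativeSectionalCurvature (h : IsRadialOn g α U) {A B : ℝ}
    (hα : ∀ p ∈ U, α (‖p‖ ^ 2) = A * ‖p‖ ^ 2 + B) (hα' : ∀ p ∈ U, deriv α (‖p‖ ^ 2) = A)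
    (hα'' : ∀ p ∈ U, deriv (deriv α) (‖p‖ ^ 2) = 0) (h0 : ∀ p ∈ U, p ≠ 0) :
    HasPointwiseConstantRelativeSectionalCurvature g U := by
  -- `f` makes `f ⟪p, ·⟫` a unit covector. It is written with `A s + B` because `α` itself is only
  -- assumed twice differentiable.
  let f : W → ℝ := fun p => 1 / Real.sqrt ((1 - (A * ‖p‖ ^ 2 + B) * ‖p‖ ^ 2) * ‖p‖ ^ 2)
  have hpos : ∀ p ∈ U, 0 < (1 - (A * ‖p‖ ^ 2 + B) * ‖p‖ ^ 2) * ‖p‖ ^ 2 := fun p hp => by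
    have hD := h.pos p hp
    have := h0 p hp
    rw [hα p hp] at hD
    positivity
  have hfpos : ∀ p ∈ U, 0 < f p := fun p hp => by
    have := Real.sqrt_pos.mpr (hpos p hp)
    positivity
  have hf : ContDiffOn ℝ ∞ f U := by
    have hn : ContDiff ℝ ∞ fun p : W => ‖p‖ ^ 2 := contDiff_norm_sq ℝ
    have hP : ContDiff ℝ ∞ fun p : W => (1 - (A * ‖p‖ ^ 2 + B) * ‖p‖ ^ 2) * ‖p‖ ^ 2 := by
      fun_prop
    exact contDiffOn_const.div (hP.contDiffOn.sqrt fun p hp => (hpos p hp).ne')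
      fun p hp => (Real.sqrt_pos.mpr (hpos p hp)).ne'
  let η : W → W →L[ℝ] ℝ := fun p => f p • euclideanMetric W p
  have hform : ∀ p ∈ U, ∀ E : Submodule ℝ W,
      SectionalFormEq g p E ((4 * A / f p) • η p) := by
    rintro p hp E x y ⟨hx, hy, hxy, rfl⟩ z hz
    have := (hfpos p hp).ne'
    rw [h.covDerivCurvature_eq hp hx hy hxy hz, hα' p hp, hα'' p hp]
    simp only [η, smul_apply, euclideanMetric_apply, smul_eq_mul]
    field_simp
    ring
  refine ⟨η, ⟨⟨?_, fun p hp => ?_⟩, fun p hp E _ => ⟨fun _ => ⟨_, hform p hp E⟩, fun hle => ?_⟩⟩,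
    fun p hp => ⟨_, fun E _ _ => hform p hp E⟩⟩
  · exact hf.smul (euclideanMetric W).contDiff.contDiffOn
  · have hD := h.pos p hp
    have hf2 : f p ^ 2 * ((1 - (A * ‖p‖ ^ 2 + B) * ‖p‖ ^ 2) * ‖p‖ ^ 2) = 1 := by
      have := hpos p hp
      simp only [f, div_pow, one_pow, Real.sq_sqrt this.le]
      exact one_div_mul_cancel this.ne'
    refine ⟨(f p * (1 - α (‖p‖ ^ 2) * ‖p‖ ^ 2)) • p, ?_, ?_⟩
    · simp only [map_smul, smul_apply, h.apply_self hp, real_inner_self_eq_norm_sq, smul_eq_mul]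
      rw [← hα p hp] at hf2
      rw [mul_div_assoc', mul_div_assoc', div_eq_iff hD.ne']
      linear_combination (1 - α (‖p‖ ^ 2) * ‖p‖ ^ 2) * hf2
    · ext v
      simp only [η, map_smul, smul_apply, h.apply_self hp, euclideanMetric_apply, smul_eq_mul]
      rw [mul_div_assoc', eq_div_iff hD.ne']
      ring
  · rintro x y hE z hz
    have h1 := hform p hp E x y hE z hz
    have h2 : η p z = 0 := hle hz
    simpa [h2] using h1

end IsRadialOn
end Radial
-- The rotational hypersurface as a radial metric
section Rotational

variable {V : Type*} [NormedAddCommGroup V] [InnerProductSpace ℝ V]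

/-- Writing `‖v‖ = √(‖v‖²)` reduces this to functions of the squared norm. -/
theorem hasFDerivAt_comp_norm {W : Type*} [NormedAddCommGroup W] [InnerProductSpace ℝ W]
    {t : ℝ → ℝ} {t' : ℝ} {w : W} (hw : w ≠ 0) (ht : HasDerivAt t t' ‖w‖) :
    HasFDerivAt (fun v : W => t ‖v‖) ((t' / ‖w‖) • innerSL ℝ w) w := by
  have hpos : 0 < ‖w‖ := norm_pos_iff.mpr hw
  have hs : HasDerivAt (fun s => t (Real.sqrt s)) (t' * (1 / (2 * ‖w‖))) (‖w‖ ^ 2) := by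
    have h1 := Real.hasDerivAt_sqrt (x := ‖w‖ ^ 2) (by positivity)
    rw [Real.sqrt_sq hpos.le] at h1
    refine HasDerivAt.comp _ ?_ h1
    rwa [Real.sqrt_sq hpos.le]
  have h := hasFDerivAt_comp_normSq hs
  simp only [Real.sqrt_sq (norm_nonneg _)] at h
  refine h.congr_fderiv ?_
  congr 1
  field_simp

theorem rotationalMetric_apply {o e : V} (he : ‖e‖ = 1) {t : ℝ → ℝ} {w : (ℝ ∙ e)ᗮ} (hw : w ≠ 0)
    (ht : DifferentiableAt ℝ t ‖w‖) (x y : (ℝ ∙ e)ᗮ) :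
    rotationalMetric o e t w x y =
      ⟪x, y⟫ + deriv t ‖w‖ ^ 2 / ‖w‖ ^ 2 * (⟪w, x⟫ * ⟪w, y⟫) := by
  have h1 : HasFDerivAt (rotationalChart o e t)
      ((ℝ ∙ e)ᗮ.subtypeL + (((deriv t ‖w‖) / ‖w‖) • innerSL ℝ w).smulRight e) w :=
    ((ℝ ∙ e)ᗮ.subtypeL.hasFDerivAt.const_add o).add
      ((hasFDerivAt_comp_norm hw ht.hasDerivAt).smul_const e)
  have hx : ∀ v : (ℝ ∙ e)ᗮ, ⟪(v : V), e⟫ = 0 := fun v =>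
    Submodule.mem_orthogonal_singleton_iff_inner_left.mp v.2
  have hx' : ∀ v : (ℝ ∙ e)ᗮ, ⟪e, (v : V)⟫ = 0 := fun v =>
    Submodule.mem_orthogonal_singleton_iff_inner_right.mp v.2
  simp only [rotationalMetric, firstFundamentalForm, ContinuousLinearMap.bilinearComp_apply,
    h1.fderiv, innerSL_apply_apply, add_apply, smul_apply, Submodule.subtypeL_apply,
    ContinuousLinearMap.smulRight_apply, smul_eq_mul, inner_add_left, inner_add_right,
    real_inner_smul_left, real_inner_smul_right, hx, hx', real_inner_self_eq_norm_sq, he,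
    Submodule.coe_inner]
  ring

/-- The curvature of the planes tangent to the parallels of the rotational hypersurface with
meridian `t`, as a function of the square of the distance from the axis. -/
noncomputable def parallelCurvature (t : ℝ → ℝ) (s : ℝ) : ℝ :=
  deriv t (Real.sqrt s) ^ 2 / (s * (1 + deriv t (Real.sqrt s) ^ 2))

theorem parallelCurvature_sq (t : ℝ → ℝ) {r : ℝ} (hr : 0 < r) :
    parallelCurvature t (r ^ 2) = deriv t r ^ 2 / (r ^ 2 * (1 + deriv t r ^ 2)) := by
  rw [parallelCurvature, Real.sqrt_sq hr.le]

/-- This gives both the positivity required in `IsRadialOn` and the bound `α r² < 1`. -/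
theorem one_sub_parallelCurvature_mul (t : ℝ → ℝ) {r : ℝ} (hr : 0 < r) :
    1 - parallelCurvature t (r ^ 2) * r ^ 2 = 1 / (1 + deriv t r ^ 2) := by
  have : 0 < 1 + deriv t r ^ 2 := by positivity
  rw [parallelCurvature_sq t hr]
  field_simp
  ring

/-- The squares of the radii in `I`. -/
def squaredRadii (I : Set ℝ) : Set ℝ := {s | 0 < s ∧ Real.sqrt s ∈ I}

theorem isOpen_squaredRadii {I : Set ℝ} (hI : IsOpen I) : IsOpen (squaredRadii I) :=
  isOpen_Ioi.inter (hI.preimage Real.continuous_sqrt)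

theorem isPreconnected_squaredRadii {I : Set ℝ} (hI : I.OrdConnected) :
    IsPreconnected (squaredRadii I) := by
  refine Set.OrdConnected.isPreconnected ⟨fun a ha b hb c hc => ⟨ha.1.trans_le hc.1, ?_⟩⟩
  exact hI.out ha.2 hb.2 ⟨Real.sqrt_le_sqrt hc.1, Real.sqrt_le_sqrt hc.2⟩

theorem sq_mem_squaredRadii {I : Set ℝ} {r : ℝ} (hr : r ∈ I) (h : 0 < r) :
    r ^ 2 ∈ squaredRadii I := by
  refine ⟨by positivity, ?_⟩
  rwa [Real.sqrt_sq h.le]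

theorem contDiffOn_parallelCurvature {I : Set ℝ} (hI : IsOpen I) {t : ℝ → ℝ}
    (ht : ContDiffOn ℝ ∞ t I) : ContDiffOn ℝ ∞ (parallelCurvature t) (squaredRadii I) := by
  have h1 : ContDiffOn ℝ ∞ (deriv t) I := ht.deriv_of_isOpen hI (by simp)
  have h2 : ContDiffOn ℝ ∞ (fun s => deriv t (Real.sqrt s)) (squaredRadii I) :=
    h1.comp (contDiffOn_id.sqrt fun s hs => hs.1.ne') fun s hs => hs.2
  refine (h2.pow 2).div (contDiffOn_id.mul (contDiffOn_const.add (h2.pow 2))) fun s hs => ?_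
  have : 0 < s := hs.1
  change s * (1 + deriv t (Real.sqrt s) ^ 2) ≠ 0
  positivity

theorem isRadialOn_rotationalMetric {o e : V} (he : ‖e‖ = 1) {I : Set ℝ} (hI : IsOpen I)
    (hI_pos : ∀ r ∈ I, 0 < r) {t : ℝ → ℝ} (ht : ContDiffOn ℝ ∞ t I) :
    IsRadialOn (rotationalMetric o e t) (parallelCurvature t) (rotationalDomain e I) := by
  have hα := contDiffOn_parallelCurvature hI ht
  have hJ := isOpen_squaredRadii hI
  have hα' : ContDiffOn ℝ ∞ (deriv (parallelCurvature t)) (squaredRadii I) :=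
    hα.deriv_of_isOpen hJ (by simp)
  have hmem : ∀ w ∈ rotationalDomain e I, ‖w‖ ^ 2 ∈ squaredRadii I :=
    fun w hw => sq_mem_squaredRadii hw (hI_pos _ hw)
  refine ⟨hI.preimage continuous_norm, fun w hw => ?_, fun w hw => ?_, fun w hw => ?_,
    fun w hw => ?_⟩
  · have hw0 : 0 < ‖w‖ := hI_pos _ hw
    have h1 : 0 < 1 + deriv t ‖w‖ ^ 2 := by positivity
    ext x y
    rw [rotationalMetric_apply he (norm_pos_iff.mp hw0)
      ((ht.differentiableOn (by simp)).differentiableAt (hI.mem_nhds hw)), radialMetric_apply,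
      one_sub_parallelCurvature_mul t hw0, parallelCurvature_sq t hw0]
    congr 2
    field_simp
  · exact (hα.differentiableOn (by simp)).differentiableAt (hJ.mem_nhds (hmem w hw))
  · exact (hα'.differentiableOn (by simp)).differentiableAt (hJ.mem_nhds (hmem w hw))
  · rw [one_sub_parallelCurvature_mul t (hI_pos _ hw)]
    positivity

/-- The rotational hypersurface has pointwise constant relative sectional curvature if and only if
the curvature of the planes tangent to the parallels is an affine function of `r ^ 2`. -/
theorem hasPointwiseConstantRelativeSectionalCurvature_iff [FiniteDimensional ℝ V]
    (hV : 4 ≤ Module.finrank ℝ V) {o e : V} (he : ‖e‖ = 1) {I : Set ℝ} (hI : IsOpen I)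
    (hI_conn : I.OrdConnected) (hI_pos : ∀ r ∈ I, 0 < r) {t : ℝ → ℝ} (ht : ContDiffOn ℝ ∞ t I) :
    HasPointwiseConstantRelativeSectionalCurvature (rotationalMetric o e t)
        (rotationalDomain e I) ↔
      ∃ A B : ℝ, ∀ r ∈ I, parallelCurvature t (r ^ 2) = A * r ^ 2 + B := by
  have he0 : e ≠ 0 := by
    rintro rfl
    simp at he
  have hW : 3 ≤ Module.finrank ℝ (ℝ ∙ e)ᗮ := by
    have h1 := Submodule.finrank_add_finrank_orthogonal (ℝ ∙ e)
    rw [finrank_span_singleton he0] at h1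
    omega
  have : Nontrivial (ℝ ∙ e)ᗮ := Module.nontrivial_of_finrank_pos (R := ℝ) (by omega)
  have hr := isRadialOn_rotationalMetric (o := o) he hI hI_pos ht
  have hJ := isOpen_squaredRadii hI
  have hα := contDiffOn_parallelCurvature hI ht
  have hα' : ContDiffOn ℝ ∞ (deriv (parallelCurvature t)) (squaredRadii I) :=
    hα.deriv_of_isOpen hJ (by simp)
  have h0 : ∀ w ∈ rotationalDomain e I, w ≠ 0 := fun w hw =>
    norm_pos_iff.mp (hI_pos _ hw)
  constructor
  · intro hc
    -- Every `s` in `squaredRadii I` is the squared norm of a point of the chart, so `α'' = 0` holds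
    -- on a whole interval and can be integrated twice.
    have hd2 : ∀ s ∈ squaredRadii I, deriv (deriv (parallelCurvature t)) s = 0 := by
      intro s hs
      obtain ⟨w, hw⟩ := exists_norm_eq (ℝ ∙ e)ᗮ (Real.sqrt_nonneg s)
      have hwI : w ∈ rotationalDomain e I := by
        rw [rotationalDomain, Set.mem_ofPred_eq, hw]
        exact hs.2
      have := hr.deriv_deriv_eq_zero hW hc hwI (h0 w hwI)
      rwa [hw, Real.sq_sqrt hs.1.le] at this
    obtain ⟨A, hA⟩ := hJ.exists_is_const_of_deriv_eq_zero (isPreconnected_squaredRadii hI_conn)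
      (hα'.differentiableOn (by simp)) hd2
    have hdiff := hα.differentiableOn (by simp)
    obtain ⟨B, hB⟩ := hJ.exists_is_const_of_deriv_eq_zero
      (f := fun s => parallelCurvature t s - A * s) (isPreconnected_squaredRadii hI_conn)
      (hdiff.sub (by fun_prop)) (fun s hs => by
        have h1 := (hdiff.differentiableAt (hJ.mem_nhds hs)).hasDerivAt.sub
          ((hasDerivAt_id s).const_mul A)
        exact h1.deriv.trans (by simp [hA s hs]))
    refine ⟨A, B, fun r hrI => ?_⟩
    have := hB _ (sq_mem_squaredRadii hrI (hI_pos r hrI))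
    linarith
  · rintro ⟨A, B, hAB⟩
    have hEq : Set.EqOn (parallelCurvature t) (fun s => A * s + B) (squaredRadii I) := by
      intro s hs
      simpa [Real.sq_sqrt hs.1.le] using hAB _ hs.2
    have hEq1 : Set.EqOn (deriv (parallelCurvature t)) (fun _ => A) (squaredRadii I) :=
      fun s hs => (hEq.deriv hJ hs).trans (by simp)
    have hEq2 : Set.EqOn (deriv (deriv (parallelCurvature t))) (fun _ => 0) (squaredRadii I) :=
      fun s hs => (hEq1.deriv hJ hs).trans (by simp)
    have hmem : ∀ w ∈ rotationalDomain e I, ‖w‖ ^ 2 ∈ squaredRadii I :=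
      fun w hw => sq_mem_squaredRadii hw (hI_pos _ hw)
    exact hr.hasPointwiseConstantRelativeSectionalCurvature (fun w hw => hEq (hmem w hw))
      (fun w hw => hEq1 (hmem w hw)) (fun w hw => hEq2 (hmem w hw)) h0

end Rotational
-- The meridian equation
/-- The slope `s √(A s² + B) / √(1 - A s⁴ - B s²)` of a meridian for which the curvature of the
planes tangent to the parallels is `A s² + B`. -/
noncomputable def meridianSlope (A B s : ℝ) : ℝ :=
  s * Real.sqrt (A * s ^ 2 + B) / Real.sqrt (1 - A * s ^ 4 - B * s ^ 2)

section Meridian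

variable {A B : ℝ} {I : Set ℝ}

theorem meridianSlope_sq {r : ℝ} (h0 : 0 ≤ A * r ^ 2 + B) (h1 : (A * r ^ 2 + B) * r ^ 2 < 1) :
    meridianSlope A B r ^ 2 = (A * r ^ 2 + B) * r ^ 2 / (1 - (A * r ^ 2 + B) * r ^ 2) := by
  have h2 : 1 - A * r ^ 4 - B * r ^ 2 = 1 - (A * r ^ 2 + B) * r ^ 2 := by ring
  rw [meridianSlope, h2, div_pow, mul_pow, Real.sq_sqrt h0, Real.sq_sqrt (by linarith), mul_comm]

theorem meridianSlope_pos {r : ℝ} (hr : 0 < r) (h0 : 0 < A * r ^ 2 + B)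
    (h1 : (A * r ^ 2 + B) * r ^ 2 < 1) : 0 < meridianSlope A B r := by
  have h2 : 0 < 1 - A * r ^ 4 - B * r ^ 2 := by linarith
  exact div_pos (mul_pos hr (Real.sqrt_pos.mpr h0)) (Real.sqrt_pos.mpr h2)

theorem continuousOn_meridianSlope (h1 : ∀ r ∈ I, (A * r ^ 2 + B) * r ^ 2 < 1) :
    ContinuousOn (meridianSlope A B) I := by
  unfold meridianSlope
  refine ContinuousOn.div (by fun_prop) (by fun_prop) fun r hr => (Real.sqrt_pos.mpr ?_).ne'
  have := h1 r hr
  linarith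

/-- A function with derivative `c f` on an interval is `c` times an integral of `f`. -/
theorem forall_sub_eq_integral_iff {t f : ℝ → ℝ} (hI : IsOpen I) (hI_conn : I.OrdConnected)
    (ht : DifferentiableOn ℝ t I) (hf : ContinuousOn f I) (c : ℝ) :
    (∀ r₀ ∈ I, ∀ r ∈ I, t r - t r₀ = c * ∫ s in r₀..r, f s) ↔ ∀ r ∈ I, deriv t r = c * f r := by
  constructor
  · intro h r hr
    -- With the base point at `r` itself, integrability is only needed on a degenerate interval.
    have hint : HasDerivAt (fun u => ∫ s in r..u, f s) (f r) r :=
      intervalIntegral.integral_hasDerivAt_right IntervalIntegrable.refl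
        (hf.stronglyMeasurableAtFilter hI r hr) (hf.continuousAt (hI.mem_nhds hr))
    have h1 : t =ᶠ[nhds r] fun u => t r + c * ∫ s in r..u, f s :=
      Filter.eventually_of_mem (hI.mem_nhds hr) fun u hu => by linarith [h r hr u hu]
    exact (((hint.const_mul c).const_add (t r)).congr_of_eventuallyEq h1).deriv
  · intro h r₀ hr₀ r hr
    have hsub : Set.uIcc r₀ r ⊆ I := hI_conn.uIcc_subset hr₀ hr
    rw [← intervalIntegral.integral_const_mul]
    refine (intervalIntegral.integral_eq_sub_of_hasDerivAt (fun x hx => ?_) ?_).symm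
    · rw [← h x (hsub hx)]
      exact (ht.differentiableAt (hI.mem_nhds (hsub hx))).hasDerivAt
    · exact ((hf.mono hsub).const_smul c).intervalIntegrable

theorem parallelCurvature_eq_iff {t : ℝ → ℝ} {r k : ℝ} (hr : 0 < r) (h : k * r ^ 2 < 1) :
    parallelCurvature t (r ^ 2) = k ↔ deriv t r ^ 2 = k * r ^ 2 / (1 - k * r ^ 2) := by
  have h1 : 0 < 1 - k * r ^ 2 := by linarith
  have h2 : 0 < r ^ 2 * (1 + deriv t r ^ 2) := by positivity
  rw [parallelCurvature_sq t hr, div_eq_iff h2.ne', eq_div_iff h1.ne']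
  constructor <;> intro h <;> linarith

theorem parallelCurvature_nonneg (t : ℝ → ℝ) {r : ℝ} (hr : 0 < r) :
    0 ≤ parallelCurvature t (r ^ 2) := by
  rw [parallelCurvature_sq t hr]
  positivity

theorem parallelCurvature_mul_lt_one (t : ℝ → ℝ) {r : ℝ} (hr : 0 < r) :
    parallelCurvature t (r ^ 2) * r ^ 2 < 1 := by
  have h := one_sub_parallelCurvature_mul t hr
  have : 0 < 1 / (1 + deriv t r ^ 2) := by positivity
  linarith

/-- An affine function of `r ^ 2` that is nonnegative on an open set of positive numbers and
vanishes at one of them vanishes identically. -/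
theorem eq_zero_of_affine_sq_nonneg (hI : IsOpen I) (hI_pos : ∀ r ∈ I, 0 < r)
    (h : ∀ r ∈ I, 0 ≤ A * r ^ 2 + B) {r : ℝ} (hr : r ∈ I) (h0 : A * r ^ 2 + B = 0) :
    A = 0 ∧ B = 0 := by
  -- The zero is interior, so a nonzero `A` would make the affine function negative on one side of
  -- it.
  obtain ⟨δ, hδ, hball⟩ := Metric.isOpen_iff.mp hI r hr
  have h1 : r - δ / 2 ∈ I :=
    hball (by rw [Metric.mem_ball, Real.dist_eq, abs_lt]; constructor <;> linarith)
  have h2 : r + δ / 2 ∈ I :=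
    hball (by rw [Metric.mem_ball, Real.dist_eq, abs_lt]; constructor <;> linarith)
  have hr0 := hI_pos r hr
  have hA1 : A * ((r - δ / 2) ^ 2 - r ^ 2) ≥ 0 := by linarith [h _ h1]
  have hA2 : A * ((r + δ / 2) ^ 2 - r ^ 2) ≥ 0 := by linarith [h _ h2]
  have hn1 : (r - δ / 2) ^ 2 - r ^ 2 < 0 := by nlinarith [hI_pos _ h1]
  have hn2 : (r + δ / 2) ^ 2 - r ^ 2 > 0 := by nlinarith
  have hA : A = 0 := by
    apply le_antisymm
    · by_contra! hA
      nlinarith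
    · by_contra! hA
      nlinarith
  exact ⟨hA, by simpa [hA] using h0⟩

/-- The meridians for which the curvature of the planes tangent to the parallels is affine
in `r ^ 2`. -/
theorem exists_parallelCurvature_eq_iff (hI : IsOpen I) (hI_conn : I.OrdConnected)
    (hI_pos : ∀ r ∈ I, 0 < r) {t : ℝ → ℝ} (ht : ContDiffOn ℝ ∞ t I)
    (ht_nonconst : ¬ ∃ c : ℝ, ∀ r ∈ I, t r = c) :
    (∃ A B : ℝ, ∀ r ∈ I, parallelCurvature t (r ^ 2) = A * r ^ 2 + B) ↔
      ∃ A B ε : ℝ, (ε = 1 ∨ ε = -1) ∧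
        (∀ r ∈ I, 0 < (A * r ^ 2 + B) * r ^ 2 ∧ (A * r ^ 2 + B) * r ^ 2 < 1) ∧
        ∀ r₀ ∈ I, ∀ r ∈ I, t r - t r₀ = ε * ∫ s in r₀..r, meridianSlope A B s := by
  have htd : DifferentiableOn ℝ t I := ht.differentiableOn (by simp)
  constructor
  · rintro ⟨A, B, hAB⟩
    have hlt : ∀ r ∈ I, (A * r ^ 2 + B) * r ^ 2 < 1 := fun r hr =>
      hAB r hr ▸ parallelCurvature_mul_lt_one t (hI_pos r hr)
    have hnn : ∀ r ∈ I, 0 ≤ A * r ^ 2 + B := fun r hr =>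
      hAB r hr ▸ parallelCurvature_nonneg t (hI_pos r hr)
    have hsq : ∀ r ∈ I, deriv t r ^ 2 = meridianSlope A B r ^ 2 := fun r hr => by
      rw [meridianSlope_sq (hnn r hr) (hlt r hr),
        ← parallelCurvature_eq_iff (hI_pos r hr) (hlt r hr), hAB r hr]
    have hpos : ∀ r ∈ I, 0 < A * r ^ 2 + B := by
      intro r hr
      refine (hnn r hr).lt_of_ne fun h0 => ht_nonconst ?_
      obtain ⟨rfl, rfl⟩ := eq_zero_of_affine_sq_nonneg hI hI_pos hnn hr h0.symm
      refine hI.exists_is_const_of_deriv_eq_zero hI_conn.isPreconnected htd fun s hs => ?_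
      simpa [meridianSlope] using hsq s hs
    have hcont := continuousOn_meridianSlope hlt
    -- Two continuous functions with equal squares, one of them without zeros, agree up to a single
    -- sign on a connected set; this sign is `ε`.
    have hsign := hI_conn.isPreconnected.eq_or_eq_neg_of_sq_eq
      (ht.continuousOn_deriv_of_isOpen hI (by simp)) hcont hsq
      fun {r} hr => (meridianSlope_pos (hI_pos r hr) (hpos r hr) (hlt r hr)).ne'
    have hbound : ∀ r ∈ I, 0 < (A * r ^ 2 + B) * r ^ 2 ∧ (A * r ^ 2 + B) * r ^ 2 < 1 :=
      fun r hr => ⟨mul_pos (hpos r hr) (pow_pos (hI_pos r hr) 2), hlt r hr⟩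
    obtain h | h := hsign
    · exact ⟨A, B, 1, Or.inl rfl, hbound,
        (forall_sub_eq_integral_iff hI hI_conn htd hcont 1).mpr fun r hr => by simp [h hr]⟩
    · exact ⟨A, B, -1, Or.inr rfl, hbound,
        (forall_sub_eq_integral_iff hI hI_conn htd hcont (-1)).mpr fun r hr => by simp [h hr]⟩
  · rintro ⟨A, B, ε, hε, hbound, hint⟩
    have hcont := continuousOn_meridianSlope fun r hr => (hbound r hr).2
    refine ⟨A, B, fun r hr => (parallelCurvature_eq_iff (hI_pos r hr) (hbound r hr).2).mpr ?_⟩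
    have h0 : 0 < A * r ^ 2 + B := pos_of_mul_pos_left (hbound r hr).1 (sq_nonneg r)
    have hε2 : ε ^ 2 = 1 := by rcases hε with rfl | rfl <;> norm_num
    rw [(forall_sub_eq_integral_iff hI hI_conn htd hcont ε).mp hint r hr, mul_pow, hε2, one_mul,
      meridianSlope_sq h0.le (hbound r hr).2]

end Meridian

end RelCurv

theorem proposition3p3 (n : ℕ) (hn : 3 ≤ n)
    (o e : EuclideanSpace ℝ (Fin (n + 1))) (he : ‖e‖ = 1)
    (I : Set ℝ) (hI : IsOpen I) (hI_conn : I.OrdConnected) (hI_pos : ∀ r ∈ I, 0 < r)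
    (t : ℝ → ℝ) (ht : ContDiffOn ℝ ∞ t I) (ht_nonconst : ¬ ∃ c : ℝ, ∀ r ∈ I, t r = c) :
    RelCurv.HasPointwiseConstantRelativeSectionalCurvature
        (RelCurv.rotationalMetric o e t) (RelCurv.rotationalDomain e I) ↔
      ∃ A B ε : ℝ, (ε = 1 ∨ ε = -1) ∧
        (∀ r ∈ I, 0 < (A * r ^ 2 + B) * r ^ 2 ∧ (A * r ^ 2 + B) * r ^ 2 < 1) ∧
        ∀ r₀ ∈ I, ∀ r ∈ I,
          t r - t r₀ = ε * ∫ s in r₀..r,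
            s * Real.sqrt (A * s ^ 2 + B) / Real.sqrt (1 - A * s ^ 4 - B * s ^ 2) := by
  rw [RelCurv.hasPointwiseConstantRelativeSectionalCurvature_iff
    (by rw [finrank_euclideanSpace_fin]; omega) he hI hI_conn hI_pos ht]
  exact RelCurv.exists_parallelCurvature_eq_iff hI hI_conn hI_pos ht ht_nonconst
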